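/- **Setting.** Let $X$ be a real or complex Banach space and let $\mathcal T=\{T(t)\}_{t\ge 0}\subset L(X)$ be a bounded $C_0$-semigroup. Let $$X^\odot=\{x^*\in X^*:\ \lim_{t\to0}\|T^*(t)x^*-x^*\|=0\},\qquad T^\odot(t)=T^*(t)|_{X^\odot}\in L(X^\odot),\qquad \mathcal T^\odot=\{T^\odot(t)\}_{t\ge0}.$$ Let $X^{\odot\odot}\subset X^{\odot *}$ be the sun-dual space of the $C_0$-semigroup $\mathcal T^\odot$ on $X^\odot$. Let $j:X\to X^{\odot\odot}$, $\langle jx,x^\odot\rangle=\langle x,x^\odot\rangle$, be the natural embedding. We identify $T(t)$ with $jT(t)\in L(X,X^{\odot\odot})\subset L(X,X^{\odot*})$, and $T^\odot(t)$ with an element of $L(X^\odot)\subset L(X^\odot,X^*)$. For normed spaces $E,F$, the space $L(E,F^*)=(E\hat\otimes_\pi F)^*$ carries its $w^*$-topology. Closures below are taken in this topology, in $L(X,X^{\odot*})$ for $\mathcal T$ and in $L(X^\odot,X^*)$ for $\mathcal T^\odot$. We write $\overline{\mathrm{co}}^{w^*}$ and $\overline{\mathrm{ac}}^{w^*}$ for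 the $w^*$-closure of the convex hull and of the absolutely convex hull. For $U\in L(X,X^{\odot\odot})$ put $\langle x,U^*x^\odot\rangle=\langle Ux,x^\odot\rangle$ for $x\in X$, $x^\odot\in X^\odot$; if $U^*(X^\odot)\subset X^\odot$, write $U^\odot=U^*|_{X^\odot}$. Let $$L_{\mathcal T}(X^\odot)=\{S\in L(X^\odot): S^*(X^{\odot\odot})\subset X^{\odot\odot}\},$$ $$L_{\mathcal T}(X,X^{\odot\odot})=\{U\in L(X,X^{\odot\odot}): U^*(X^\odot)\subset X^\odot,\ U^{\odot*}(X^{\odot\odot})\subset X^{\odot\odot}\},$$ $$\eta^\odot:L_{\mathcal T}(X,X^{\odot\odot})\to L_{\mathcal T}(X^\odot),\qquad \eta^\odot(U)=U^\odot .$$ On $L_{\mathcal T}(X,X^{\odot\odot})$ use the product $\langle (U\circ V)x,x^\odot\rangle=\langle Vx,U^\odot x^\odot\rangle$. A *right semitopological semigroup* is a nonvoid Hausdorff space with an associative multiplication $(a,b)\mapsto ab$ such that $b\mapsto ab$ is continuous for every fixed $a$. **Theorem 7.3.** The following hold. * $\overline{\mathcal T^\odot}^{w^*}\subset L(X^\odot)$.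 * $\overline{\mathcal T}^{w^*}=(\eta^\odot)^{-1}\big(\overline{\mathcal T^\odot}^{w^*}\big)$, $\ \overline{\mathrm{co}}^{w^*}\mathcal T=(\eta^\odot)^{-1}\big(\overline{\mathrm{co}}^{w^*}\mathcal T^\odot\big)$, $\ \overline{\mathrm{ac}}^{w^*}\mathcal T=(\eta^\odot)^{-1}\big(\overline{\mathrm{ac}}^{w^*}\mathcal T^\odot\big)$; in particular these three sets lie in $L_{\mathcal T}(X,X^{\odot\odot})$. 1. $\mathcal T\subset\overline{\mathcal T}^{w^*}\subset\overline{\mathrm{co}}^{w^*}\mathcal T\subset\overline{\mathrm{ac}}^{w^*}\mathcal T\subset L(X,X^{\odot\odot})$. 2. $\overline{\mathcal T}^{w^*}$ is $w^*$-compact and, with the product $\circ$ (under which it is stable) and the $w^*$-topology, a right semitopological semigroup. 3. $\overline{\mathrm{co}}^{w^*}\mathcal T$ is convex, $w^*$-compact and, with $\circ$ (under which it is stable) and the $w^*$-topology, a right semitopological semigroup. 4. $\overline{\mathrm{ac}}^{w^*}\mathcal T$ is absolutely convex, $w^*$-compact and, with $\circ$ (under which it is stable) and the $w^*$-topology, a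 right semitopological semigroup. -/

import Mathlib

set_option maxSynthPendingDepth 3

open Filter Topology
open scoped NNReal ComplexOrder

noncomputable section

/-! ### The weak-star topology of `L(E, F*)` -/

section WStar

variable (𝕜 E F : Type*) [RCLike 𝕜] [NormedAddCommGroup E] [NormedSpace 𝕜 E]
  [NormedAddCommGroup F] [NormedSpace 𝕜 F]

variable {E F} in
/-- The functional `V ↦ ⟨y, V x⟩` on `L(E, F*)` given by the elementary tensor `x ⊗ y`. -/
def elemTensor (x : E) (y : F) : StrongDual 𝕜 (E →L[𝕜] StrongDual 𝕜 F) :=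
  (ContinuousLinearMap.apply 𝕜 𝕜 y).comp
    (ContinuousLinearMap.apply 𝕜 (StrongDual 𝕜 F) x)

/-- The completed projective tensor product of `E` and `F`, as a subspace of the bidual
`((E ⊗_π F)*)* = L(E, F*)*`.  The canonical map of `E ⊗_π F` into its bidual is isometric, so
the completion is the norm closure of the span of the elementary tensors.  It is the canonical
predual of `L(E, F*)`. -/
def projPredual : Submodule 𝕜 (StrongDual 𝕜 (E →L[𝕜] StrongDual 𝕜 F)) :=
  (Submodule.span 𝕜 (Set.range fun p : E × F => elemTensor 𝕜 p.1 p.2)).topologicalClosure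

/-- The weak-star topology on `L(E, F*)`, the dual of the completed projective tensor product:
the coarsest topology for which all functionals from the predual are continuous. -/
@[reducible] def wStar : TopologicalSpace (E →L[𝕜] StrongDual 𝕜 F) :=
  TopologicalSpace.induced
    (fun (V : E →L[𝕜] StrongDual 𝕜 F) (u : projPredual 𝕜 E F) => u.1 V) Pi.topologicalSpace

end WStar

/-! ### Right semitopological semigroups -/

/-- `S`, with topology `τ` and multiplication `μ`, is a (nonvoid, Hausdorff) right
semitopological semigroup: `μ` is associative, and continuous in its right variable. -/
structure IsRightSemitopologicalSemigroup {S : Type*} (τ : TopologicalSpace S)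
    (μ : S → S → S) : Prop where
  nonempty : Nonempty S
  t2 : @T2Space S τ
  assoc : ∀ a b c, μ (μ a b) c = μ a (μ b c)
  continuous_right : ∀ a, @Continuous S S τ τ (fun b => μ a b)

/-! ### Strongly continuous semigroups and their sun-duals -/

/-- A `C₀`-semigroup of bounded linear operators. -/
structure C0Semigroup (𝕜 X : Type*) [RCLike 𝕜] [NormedAddCommGroup X] [NormedSpace 𝕜 X] where
  toFun : ℝ≥0 → X →L[𝕜] X
  map_zero : toFun 0 = ContinuousLinearMap.id 𝕜 X
  map_add : ∀ s t, toFun (s + t) = (toFun s).comp (toFun t)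
  tendsto_zero : ∀ x, Tendsto (fun t => toFun t x) (𝓝 0) (𝓝 x)

namespace C0Semigroup

variable {𝕜 X : Type*} [RCLike 𝕜] [NormedAddCommGroup X] [NormedSpace 𝕜 X]
  (T : C0Semigroup 𝕜 X)

/-- The sun-dual space `X^⊙` of all `φ ∈ X*` with `T*(t) φ → φ` in norm as `t → 0`;
here `T*(t) φ = φ ∘ T(t)`. -/
def sun : Submodule 𝕜 (StrongDual 𝕜 X) where
  carrier := {φ | Tendsto (fun t => φ.comp (T.toFun t)) (𝓝 0) (𝓝 φ)}
  zero_mem' := by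
    simp only [Set.mem_ofPred_eq, ContinuousLinearMap.zero_comp]
    exact tendsto_const_nhds
  add_mem' := by
    intro a b ha hb
    simp only [Set.mem_ofPred_eq, ContinuousLinearMap.add_comp] at *
    exact ha.add hb
  smul_mem' := by
    intro c a ha
    simp only [Set.mem_ofPred_eq, ContinuousLinearMap.smul_comp] at *
    exact ha.const_smul c

theorem mem_sun {φ : StrongDual 𝕜 X} :
    φ ∈ T.sun ↔ Tendsto (fun t => φ.comp (T.toFun t)) (𝓝 0) (𝓝 φ) := Iff.rfl

theorem comp_mem_sun {φ : StrongDual 𝕜 X} (hφ : φ ∈ T.sun) (t : ℝ≥0) :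
    φ.comp (T.toFun t) ∈ T.sun := by
  rw [mem_sun] at *
  have h := (((ContinuousLinearMap.compL 𝕜 X X 𝕜).flip (T.toFun t)).continuous.tendsto φ).comp hφ
  have e : ∀ s, (φ.comp (T.toFun t)).comp (T.toFun s)
      = (φ.comp (T.toFun s)).comp (T.toFun t) := by
    intro s
    rw [ContinuousLinearMap.comp_assoc, ContinuousLinearMap.comp_assoc, ← T.map_add,
      ← T.map_add, add_comm]
  simp only [e]
  exact h

/-- The operator `T^⊙(t)`, the restriction of `T*(t)` to `X^⊙`. -/
def sunOp (t : ℝ≥0) : T.sun →L[𝕜] T.sun :=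
  ((((ContinuousLinearMap.compL 𝕜 X X 𝕜).flip (T.toFun t)).comp T.sun.subtypeL)).codRestrict
    T.sun (fun φ => T.comp_mem_sun φ.2 t)

theorem coe_sunOp (t : ℝ≥0) (φ : T.sun) :
    ((T.sunOp t φ : T.sun) : StrongDual 𝕜 X) = (φ : StrongDual 𝕜 X).comp (T.toFun t) := rfl

/-- The sun-dual semigroup `T^⊙` on `X^⊙`. -/
def sunDual : C0Semigroup 𝕜 T.sun where
  toFun := T.sunOp
  map_zero := by
    ext φ x
    simp [coe_sunOp, T.map_zero]
  map_add := by
    intro s t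
    ext φ x
    simp only [coe_sunOp, ContinuousLinearMap.comp_apply]
    rw [add_comm, T.map_add]
    rfl
  tendsto_zero := by
    intro φ
    rw [tendsto_subtype_rng]
    exact φ.2

/-- The space `X^⊙⊙ ⊆ X^⊙*`. -/
abbrev sunSun : Submodule 𝕜 (StrongDual 𝕜 T.sun) := T.sunDual.sun

/-- The evaluation map `X → X^⊙*`, `x ↦ (φ ↦ φ x)`. -/
def evalSun : X →L[𝕜] StrongDual 𝕜 T.sun := T.sun.subtypeL.flip

theorem evalSun_mem (x : X) : T.evalSun x ∈ T.sunSun := by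
  rw [mem_sun]
  exact (T.evalSun.continuous.tendsto x).comp (T.tendsto_zero x)

/-- The natural embedding `j : X → X^⊙⊙`. -/
def toSunSun : X →L[𝕜] T.sunSun := T.evalSun.codRestrict T.sunSun T.evalSun_mem

/-- The inclusion `L(X^⊙) ⊆ L(X^⊙, X*)`. -/
def inclSun (S : T.sun →L[𝕜] T.sun) : T.sun →L[𝕜] StrongDual 𝕜 X := T.sun.subtypeL.comp S

/-- The inclusion `L(X, X^⊙⊙) ⊆ L(X, X^⊙*)`. -/
def inclSunSun (U : X →L[𝕜] T.sunSun) : X →L[𝕜] StrongDual 𝕜 T.sun := T.sunSun.subtypeL.comp U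

/-- The set `{T^⊙(t) : t ≥ 0}`, regarded as a subset of `L(X^⊙, X*)`. -/
def sunOrbit : Set (T.sun →L[𝕜] StrongDual 𝕜 X) :=
  Set.range fun t => T.inclSun (T.sunOp t)

/-- The set `{T(t) : t ≥ 0}`, regarded through `L(X) ⊆ L(X, X^⊙⊙)` as a subset
of `L(X, X^⊙*)`. -/
def orbit : Set (X →L[𝕜] StrongDual 𝕜 T.sun) :=
  Set.range fun t => T.inclSunSun (T.toSunSun.comp (T.toFun t))

/-- The map `U*|_{X^⊙} : X^⊙ → X*`, `φ ↦ (x ↦ ⟨U x, φ⟩)`, for `U ∈ L(X, X^⊙⊙)`. -/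
def adjSun (U : X →L[𝕜] T.sunSun) : T.sun →L[𝕜] StrongDual 𝕜 X := (T.inclSunSun U).flip

theorem adjSun_apply (U : X →L[𝕜] T.sunSun) (φ : T.sun) (x : X) :
    T.adjSun U φ x = (U x : StrongDual 𝕜 T.sun) φ := rfl

/-- The space `L_𝒯(X^⊙)` of all `S ∈ L(X^⊙)` with `S*(X^⊙⊙) ⊆ X^⊙⊙`. -/
def LSun : Set (T.sun →L[𝕜] T.sun) :=
  {S | ∀ ψ ∈ T.sunSun, ψ.comp S ∈ T.sunSun}

/-- The space `L_𝒯(X, X^⊙⊙)` of all `U ∈ L(X, X^⊙⊙)` such that `U*(X^⊙) ⊆ X^⊙` and,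
writing `U^⊙ : X^⊙ → X^⊙` for the restriction of `U*`, also `U^⊙*(X^⊙⊙) ⊆ X^⊙⊙`. -/
def LSunSun : Set (X →L[𝕜] T.sunSun) :=
  {U | ∃ h : ∀ φ, T.adjSun U φ ∈ T.sun, (T.adjSun U).codRestrict T.sun h ∈ T.LSun}

/-- The operator `U^⊙ : X^⊙ → X^⊙` of `U ∈ L_𝒯(X, X^⊙⊙)`. -/
def sunAdjoint (U : T.LSunSun) : T.sun →L[𝕜] T.sun :=
  (T.adjSun U.1).codRestrict T.sun U.2.choose

theorem sunAdjoint_mem (U : T.LSunSun) : T.sunAdjoint U ∈ T.LSun := U.2.choose_spec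

theorem coe_sunAdjoint (U : T.LSunSun) (φ : T.sun) :
    (T.sunAdjoint U φ : StrongDual 𝕜 X) = T.adjSun U.1 φ := rfl

/-- The map `η^⊙ : L_𝒯(X, X^⊙⊙) → L_𝒯(X^⊙)`, `⟨x, η^⊙(U) φ⟩ = ⟨U x, φ⟩`. -/
def eta (U : T.LSunSun) : T.LSun := ⟨T.sunAdjoint U, T.sunAdjoint_mem U⟩

/-- The map `x ↦ (φ ↦ ⟨V x, U^⊙ φ⟩)` underlying the product `U ∘ V`. -/
def opMulAux (U V : T.LSunSun) : X →L[𝕜] T.sunSun :=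
  (((ContinuousLinearMap.compL 𝕜 T.sun T.sun 𝕜).flip (T.sunAdjoint U)).comp
    (T.inclSunSun V.1)).codRestrict T.sunSun (fun x => T.sunAdjoint_mem U _ (V.1 x).2)

theorem opMulAux_apply (U V : T.LSunSun) (x : X) (φ : T.sun) :
    (T.opMulAux U V x : StrongDual 𝕜 T.sun) φ
      = (V.1 x : StrongDual 𝕜 T.sun) (T.sunAdjoint U φ) := rfl

theorem opMulAux_mem (U V : T.LSunSun) : T.opMulAux U V ∈ T.LSunSun := by
  have e : ∀ φ, T.adjSun (T.opMulAux U V) φ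
      = (T.sunAdjoint V (T.sunAdjoint U φ) : StrongDual 𝕜 X) := by
    intro φ
    ext x
    rw [adjSun_apply, opMulAux_apply, coe_sunAdjoint, adjSun_apply]
  have h : ∀ φ, T.adjSun (T.opMulAux U V) φ ∈ T.sun := fun φ => by
    rw [e]
    exact Subtype.property _
  have e2 : (T.adjSun (T.opMulAux U V)).codRestrict T.sun h
      = (T.sunAdjoint V).comp (T.sunAdjoint U) := by
    ext1 φ
    exact Subtype.ext (e φ)
  refine ⟨h, ?_⟩
  rw [e2]
  intro ψ hψ
  rw [← ContinuousLinearMap.comp_assoc]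
  exact T.sunAdjoint_mem U _ (T.sunAdjoint_mem V ψ hψ)

/-- The product `U ∘ V` on `L_𝒯(X, X^⊙⊙)`, given by `⟨(U ∘ V) x, φ⟩ = ⟨V x, U^⊙ φ⟩`. -/
def opMul (U V : T.LSunSun) : T.LSunSun := ⟨T.opMulAux U V, T.opMulAux_mem U V⟩

/-- The part in `L_𝒯(X, X^⊙⊙)` of a subset of `L(X, X^⊙*)`. -/
def partLSunSun (C : Set (X →L[𝕜] StrongDual 𝕜 T.sun)) : Set T.LSunSun :=
  {U | T.inclSunSun U.1 ∈ C}

/-- `C ⊆ L(X, X^⊙*)` is contained in `L_𝒯(X, X^⊙⊙)`, stable under the product `U ∘ V`, and a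
right semitopological semigroup for this product and the relative weak-star topology. -/
def IsRightSemitopological (C : Set (X →L[𝕜] StrongDual 𝕜 T.sun)) : Prop :=
  C ⊆ Set.range (fun U : T.LSunSun => T.inclSunSun U.1) ∧
  ∃ h : ∀ U ∈ T.partLSunSun C, ∀ V ∈ T.partLSunSun C, T.opMul U V ∈ T.partLSunSun C,
    IsRightSemitopologicalSemigroup (S := T.partLSunSun C)
      (TopologicalSpace.induced (fun U => T.inclSunSun U.1.1) (wStar 𝕜 X T.sun))
      (fun U V => ⟨T.opMul U.1 V.1, h U.1 U.2 V.1 V.2⟩)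

/-- The image in `L(X, X^⊙*)` of the preimage `(η^⊙)⁻¹(D)`, for `D ⊆ L(X^⊙, X*)`. -/
def etaPreimage (D : Set (T.sun →L[𝕜] StrongDual 𝕜 X)) :
    Set (X →L[𝕜] StrongDual 𝕜 T.sun) :=
  (fun U : T.LSunSun => T.inclSunSun U.1) '' {U | T.inclSun (T.eta U).1 ∈ D}

end C0Semigroup

end

/-! The three closures stay in `commutant`, the space of all V : X → X^⊙* with ⟨V x, T^⊙(t)φ⟩ = ⟨V
T(t)x, φ⟩. It contains the orbit and is w*-closed, since each condition tests V on two elementary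
tensors. Intertwining turns the strong continuity of 𝒯 into V x ∈ X^⊙⊙, and that of 𝒯^⊙ into V*φ ∈
X^⊙; so `commutant` lies in L_𝒯(X, X^⊙⊙).

Swapping the two arguments (`flipDual`) is a linear w*-homeomorphism exchanging the orbits of 𝒯 and
𝒯^⊙, hence also their closed hulls; on L_𝒯(X, X^⊙⊙) it is η^⊙. Compactness is Banach-Alaoglu.

Stability under ∘ extends from the orbit in two rounds: U ↦ U T(t) is w*-continuous and preserves
the orbit, hence each hull C; then, for U in C, V ↦ U ∘ V is w*-continuous and sends the orbit into
C, hence C into C. -/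

/-! ### The w*-topology: continuity, linear structure, compactness. -/

section WStarTopology

variable {𝕜 E F E' F' : Type*} [RCLike 𝕜]
  [NormedAddCommGroup E] [NormedSpace 𝕜 E] [NormedAddCommGroup F] [NormedSpace 𝕜 F]
  [NormedAddCommGroup E'] [NormedSpace 𝕜 E'] [NormedAddCommGroup F'] [NormedSpace 𝕜 F']

theorem elemTensor_apply (x : E) (y : F) (V : E →L[𝕜] StrongDual 𝕜 F) :
    elemTensor 𝕜 x y V = V x y := rfl

theorem elemTensor_mem_projPredual (x : E) (y : F) : elemTensor 𝕜 x y ∈ projPredual 𝕜 E F :=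
  Submodule.le_topologicalClosure _ (Submodule.subset_span ⟨(x, y), rfl⟩)

theorem continuous_wStar_eval {u : StrongDual 𝕜 (E →L[𝕜] StrongDual 𝕜 F)}
    (hu : u ∈ projPredual 𝕜 E F) :
    Continuous[wStar 𝕜 E F, inferInstance] (fun V => u V) := by
  let : TopologicalSpace (E →L[𝕜] StrongDual 𝕜 F) := wStar 𝕜 E F
  exact continuous_pi_iff.1 (continuous_induced_dom
    (f := fun (V : E →L[𝕜] StrongDual 𝕜 F) (u : projPredual 𝕜 E F) => u.1 V)) ⟨u, hu⟩

theorem continuous_wStar_apply (x : E) (y : F) :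
    Continuous[wStar 𝕜 E F, inferInstance] (fun V : E →L[𝕜] StrongDual 𝕜 F => V x y) :=
  continuous_wStar_eval (elemTensor_mem_projPredual x y)

theorem t2Space_wStar : @T2Space _ (wStar 𝕜 E F) := by
  let := wStar 𝕜 E F
  refine T2Space.of_injective_continuous
    (f := fun (V : E →L[𝕜] StrongDual 𝕜 F) (p : E × F) => V p.1 p.2) ?_ ?_
  · intro V W h
    ext x y
    exact congrFun h (x, y)
  · exact continuous_pi fun p => continuous_wStar_apply p.1 p.2

/-- A bounded linear map is weak-star continuous if its transpose maps elementary tensors into the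
predual. -/
theorem continuous_wStar_of_elemTensor_comp_mem
    (A : (E →L[𝕜] StrongDual 𝕜 F) →L[𝕜] (E' →L[𝕜] StrongDual 𝕜 F'))
    (hA : ∀ x y, (elemTensor 𝕜 x y).comp A ∈ projPredual 𝕜 E F) :
    Continuous[wStar 𝕜 E F, wStar 𝕜 E' F'] A := by
  -- The transpose of A is norm continuous and the predual is norm closed, so generators suffice.
  have key : ∀ u ∈ projPredual 𝕜 E' F', u.comp A ∈ projPredual 𝕜 E F := by
    let B : StrongDual 𝕜 (E' →L[𝕜] StrongDual 𝕜 F') →L[𝕜] StrongDual 𝕜 (E →L[𝕜] StrongDual 𝕜 F) :=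
      (ContinuousLinearMap.compL 𝕜 (E →L[𝕜] StrongDual 𝕜 F) (E' →L[𝕜] StrongDual 𝕜 F') 𝕜).flip A
    have hcl : IsClosed (B ⁻¹' (projPredual 𝕜 E F : Set (StrongDual 𝕜 (E →L[𝕜] StrongDual 𝕜 F)))) :=
      IsClosed.preimage B.continuous (Submodule.isClosed_topologicalClosure _)
    have hle : projPredual 𝕜 E' F' ≤ (projPredual 𝕜 E F).comap B.toLinearMap := by
      refine Submodule.topologicalClosure_minimal _ (Submodule.span_le.2 ?_) hcl
      rintro _ ⟨p, rfl⟩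
      exact hA p.1 p.2
    exact fun u hu => hle hu
  refine continuous_induced_rng.2 ?_
  let := wStar 𝕜 E F
  exact continuous_pi fun u => continuous_wStar_eval (key u.1 u.2)

variable (𝕜 E F) in
/-- The identification of `L(E, F*)` with `L(F, E*)`. -/
noncomputable def flipDual : (E →L[𝕜] StrongDual 𝕜 F) →L[𝕜] (F →L[𝕜] StrongDual 𝕜 E) :=
  (ContinuousLinearMap.flipₗᵢ 𝕜 E F 𝕜).toContinuousLinearEquiv.toContinuousLinearMap

theorem flipDual_flipDual (V : E →L[𝕜] StrongDual 𝕜 F) :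
    flipDual 𝕜 F E (flipDual 𝕜 E F V) = V := rfl

theorem continuous_wStar_flipDual :
    Continuous[wStar 𝕜 E F, wStar 𝕜 F E] (flipDual 𝕜 E F) :=
  continuous_wStar_of_elemTensor_comp_mem _ fun y x => elemTensor_mem_projPredual x y

variable (𝕜 E F) in
/-- The duality pairing of `L(E, F*)` with its canonical predual. -/
noncomputable def predualPairing : (E →L[𝕜] StrongDual 𝕜 F) →ₗ[𝕜] projPredual 𝕜 E F →ₗ[𝕜] 𝕜 :=
  LinearMap.mk₂ 𝕜 (fun V u => u.1 V) (fun _ _ u => map_add u.1 _ _) (fun _ _ u => map_smul u.1 _ _)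
    (fun _ _ _ => rfl) (fun _ _ _ => rfl)

/-- `wStar` unfolds to the weak topology of `predualPairing`, so the `WeakBilin` instances apply. -/
theorem isTopologicalAddGroup_wStar :
    @IsTopologicalAddGroup (E →L[𝕜] StrongDual 𝕜 F) (wStar 𝕜 E F) _ := by
  have h :=
    WeakBilin.instIsTopologicalAddGroup (𝕜 := 𝕜) (E := E →L[𝕜] StrongDual 𝕜 F)
      (F := projPredual 𝕜 E F) (predualPairing 𝕜 E F)
  exact h

theorem continuousSMul_wStar :
    @ContinuousSMul 𝕜 (E →L[𝕜] StrongDual 𝕜 F) inferInstance inferInstance (wStar 𝕜 E F) :=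
  WeakBilin.instContinuousSMul (predualPairing 𝕜 E F)

theorem AbsConvex.closure_wStar {s : Set (E →L[𝕜] StrongDual 𝕜 F)} (hs : AbsConvex 𝕜 s) :
    AbsConvex 𝕜 (closure[wStar 𝕜 E F] s) :=
  let := wStar 𝕜 E F
  have := isTopologicalAddGroup_wStar (𝕜 := 𝕜) (E := E) (F := F)
  have := continuousSMul_wStar (𝕜 := 𝕜) (E := E) (F := F)
  hs.closure

theorem Convex.closure_wStar {s : Set (E →L[𝕜] StrongDual 𝕜 F)} (hs : Convex ℝ s) :
    Convex ℝ (closure[wStar 𝕜 E F] s) := by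
  rw [← convex_RCLike_iff_convex_real (K := 𝕜)] at hs ⊢
  let := wStar 𝕜 E F
  have := isTopologicalAddGroup_wStar (𝕜 := 𝕜) (E := E) (F := F)
  have := continuousSMul_wStar (𝕜 := 𝕜) (E := E) (F := F)
  exact hs.closure

/-- The Banach-Alaoglu theorem for `L(E, F*)`. -/
theorem isCompact_wStar_of_isClosed {C : Set (E →L[𝕜] StrongDual 𝕜 F)} {M : ℝ}
    (hM : ∀ V ∈ C, ‖V‖ ≤ M) (hC : IsClosed[wStar 𝕜 E F] C) : @IsCompact _ (wStar 𝕜 E F) C := by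
  rcases C.eq_empty_or_nonempty with rfl | ⟨V₀, hV₀⟩
  · exact @isCompact_empty _ (wStar 𝕜 E F)
  have hM0 : 0 ≤ M := (norm_nonneg _).trans (hM V₀ hV₀)
  refine (@isCompact_iff_ultrafilter_le_nhds _ (wStar 𝕜 E F) _).2 fun f hf => ?_
  have hfC : ∀ᶠ V in (f : Filter _), V ∈ C := le_principal_iff.1 hf
  -- Limits are taken along every functional, not only the predual: this makes `a` a bounded
  -- functional on the whole dual, which later passes from the span of the tensors to its closure.
  have hlim : ∀ u : StrongDual 𝕜 (E →L[𝕜] StrongDual 𝕜 F),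
      ∃ a : 𝕜, ‖a‖ ≤ M * ‖u‖ ∧ Tendsto (fun V => u V) f (𝓝 a) := by
    intro u
    have h : ∀ᶠ V in (f : Filter _), u V ∈ Metric.closedBall (0 : 𝕜) (M * ‖u‖) := by
      filter_upwards [hfC] with V hV
      rw [mem_closedBall_zero_iff, mul_comm]
      exact (u.le_opNorm V).trans (by gcongr; exact hM V hV)
    obtain ⟨a, ha, hfa⟩ := (isCompact_closedBall (0 : 𝕜) (M * ‖u‖)).ultrafilter_le_nhds
      (f.map fun V => u V) (le_principal_iff.2 h)
    exact ⟨a, mem_closedBall_zero_iff.1 ha, hfa⟩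
  choose a ha hfa using hlim
  have hadd : ∀ u v, a (u + v) = a u + a v := fun u v =>
    tendsto_nhds_unique (hfa (u + v)) ((hfa u).add (hfa v))
  have hsmul : ∀ (c : 𝕜) u, a (c • u) = c • a u := fun c u =>
    tendsto_nhds_unique (hfa (c • u)) ((hfa u).const_smul c)
  let Λ : StrongDual 𝕜 (StrongDual 𝕜 (E →L[𝕜] StrongDual 𝕜 F)) :=
    LinearMap.mkContinuous ⟨⟨a, hadd⟩, hsmul⟩ M ha
  have hnorm : ∀ (x : E) (y : F), ‖a (elemTensor 𝕜 x y)‖ ≤ M * ‖x‖ * ‖y‖ := by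
    intro x y
    refine le_of_tendsto (hfa (elemTensor 𝕜 x y)).norm ?_
    filter_upwards [hfC] with V hV
    rw [elemTensor_apply]
    refine ((V x).le_opNorm y).trans ?_
    gcongr
    exact (V.le_opNorm x).trans (by gcongr; exact hM V hV)
  let W : E →L[𝕜] StrongDual 𝕜 F := LinearMap.mkContinuous₂
    (LinearMap.mk₂ 𝕜 (fun x y => a (elemTensor 𝕜 x y))
      (fun x x' y => by
        rw [← hadd]; congr 1; ext V; simp [elemTensor_apply])
      (fun c x y => by
        rw [← hsmul]; congr 1; ext V; simp [elemTensor_apply])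
      (fun x y y' => by
        rw [← hadd]; congr 1; ext V; simp [elemTensor_apply])
      (fun c x y => by
        rw [← hsmul]; congr 1; ext V; simp [elemTensor_apply])) M hnorm
  have hW : ∀ u ∈ projPredual 𝕜 E F, a u = u W := by
    let Δ := Λ - ContinuousLinearMap.apply 𝕜 𝕜 W
    have hle : projPredual 𝕜 E F ≤ LinearMap.ker Δ.toLinearMap := by
      refine Submodule.topologicalClosure_minimal _ (Submodule.span_le.2 ?_) Δ.isClosed_ker
      rintro _ ⟨p, rfl⟩
      exact sub_eq_zero.2 rfl
    exact fun u hu => sub_eq_zero.1 (hle hu)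
  have hfW : (f : Filter _) ≤ @nhds _ (wStar 𝕜 E F) W := by
    rw [nhds_induced, ← tendsto_iff_comap, tendsto_pi_nhds]
    intro u
    rw [← hW u.1 u.2]
    exact hfa u.1
  refine ⟨W, ?_, hfW⟩
  let := wStar 𝕜 E F
  exact hC.mem_of_tendsto (f := id) hfW hfC

/-- The ball is cut out by the w*-closed conditions ‖V x y‖ ≤ M‖x‖‖y‖. -/
theorem norm_le_of_mem_closure_wStar {s : Set (E →L[𝕜] StrongDual 𝕜 F)} {M : ℝ} (hM0 : 0 ≤ M)
    (hM : ∀ V ∈ s, ‖V‖ ≤ M) {V : E →L[𝕜] StrongDual 𝕜 F} (hV : V ∈ closure[wStar 𝕜 E F] s) :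
    ‖V‖ ≤ M := by
  let := wStar 𝕜 E F
  refine V.opNorm_le_bound₂ hM0 fun x y => ?_
  have hcl : IsClosed {V : E →L[𝕜] StrongDual 𝕜 F | ‖V x y‖ ≤ M * ‖x‖ * ‖y‖} :=
    isClosed_le (continuous_wStar_apply x y).norm continuous_const
  refine closure_minimal (fun W hW => ?_) hcl hV
  refine ((W x).le_opNorm y).trans ?_
  gcongr
  exact (W.le_opNorm x).trans (by gcongr; exact hM W hW)

end WStarTopology

/-! ### Absolutely convex hulls. -/

section AbsConvexHull

variable {𝕜 E F E' F' : Type*} [RCLike 𝕜]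
  [NormedAddCommGroup E] [NormedSpace 𝕜 E] [NormedAddCommGroup F] [NormedSpace 𝕜 F]
  [NormedAddCommGroup E'] [NormedSpace 𝕜 E'] [NormedAddCommGroup F'] [NormedSpace 𝕜 F']

theorem AbsConvex.linear_preimage {s : Set (E' →L[𝕜] StrongDual 𝕜 F')} (hs : AbsConvex 𝕜 s)
    (A : (E →L[𝕜] StrongDual 𝕜 F) →ₗ[𝕜] (E' →L[𝕜] StrongDual 𝕜 F')) :
    AbsConvex 𝕜 (A ⁻¹' s) := by
  refine ⟨balanced_iff_smul_mem.2 fun a ha V hV => ?_, hs.2.linear_preimage A⟩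
  rw [Set.mem_preimage, map_smul]
  exact balanced_iff_smul_mem.1 hs.1 ha hV

theorem Submodule.absConvex (p : Submodule 𝕜 (E →L[𝕜] StrongDual 𝕜 F)) :
    AbsConvex 𝕜 (p : Set (E →L[𝕜] StrongDual 𝕜 F)) :=
  ⟨balanced_iff_smul_mem.2 fun _ _ _ hx => p.smul_mem _ hx,
    fun _ hx _ hy _ _ _ _ _ => p.add_mem (p.smul_mem _ hx) (p.smul_mem _ hy)⟩

theorem convexHull_real_subset_absConvexHull (s : Set (E →L[𝕜] StrongDual 𝕜 F)) :
    convexHull ℝ s ⊆ absConvexHull 𝕜 s :=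
  convexHull_min subset_absConvexHull (convex_RCLike_iff_convex_real.1 convex_absConvexHull)

theorem norm_le_of_mem_absConvexHull {s : Set (E →L[𝕜] StrongDual 𝕜 F)} {M : ℝ}
    (hM : ∀ V ∈ s, ‖V‖ ≤ M) {V : E →L[𝕜] StrongDual 𝕜 F} (hV : V ∈ absConvexHull 𝕜 s) :
    ‖V‖ ≤ M := by
  have h : AbsConvex 𝕜 (Metric.closedBall (0 : E →L[𝕜] StrongDual 𝕜 F) M) :=
    ⟨balanced_closedBall_zero, convex_RCLike_iff_convex_real.2 (convex_closedBall 0 M)⟩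
  exact mem_closedBall_zero_iff.1
    (absConvexHull_min (fun W hW => mem_closedBall_zero_iff.2 (hM W hW)) h hV)

end AbsConvexHull

/-! ### Extending w*-continuous linear maps from a set to its closed hulls. -/

section ClosedHulls

variable {𝕜 E F E' F' : Type*} [RCLike 𝕜]
  [NormedAddCommGroup E] [NormedSpace 𝕜 E] [NormedAddCommGroup F] [NormedSpace 𝕜 F]
  [NormedAddCommGroup E'] [NormedSpace 𝕜 E'] [NormedAddCommGroup F'] [NormedSpace 𝕜 F']
  {A : (E →L[𝕜] StrongDual 𝕜 F) →L[𝕜] (E' →L[𝕜] StrongDual 𝕜 F')}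
  {s : Set (E →L[𝕜] StrongDual 𝕜 F)} {C : Set (E' →L[𝕜] StrongDual 𝕜 F')}

/-- The hypothesis asks only that s land in the closure of C: multiplication by a limit operator
moves the orbit into the closed hull, not into the orbit. -/
theorem Set.MapsTo.closure_wStar (h : Set.MapsTo A s (closure[wStar 𝕜 E' F'] C))
    (hA : Continuous[wStar 𝕜 E F, wStar 𝕜 E' F'] A) :
    Set.MapsTo A (closure[wStar 𝕜 E F] s) (closure[wStar 𝕜 E' F'] C) := by
  let := wStar 𝕜 E F
  let := wStar 𝕜 E' F'
  exact h.closure_left hA isClosed_closure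

theorem Set.MapsTo.closure_convexHull_wStar
    (h : Set.MapsTo A s (closure[wStar 𝕜 E' F'] (convexHull ℝ C)))
    (hA : Continuous[wStar 𝕜 E F, wStar 𝕜 E' F'] A) :
    Set.MapsTo A (closure[wStar 𝕜 E F] (convexHull ℝ s))
      (closure[wStar 𝕜 E' F'] (convexHull ℝ C)) :=
  Set.MapsTo.closure_wStar (convexHull_min h
    ((convex_convexHull ℝ C).closure_wStar.linear_preimage (A.toLinearMap.restrictScalars ℝ))) hA

theorem Set.MapsTo.closure_absConvexHull_wStar
    (h : Set.MapsTo A s (closure[wStar 𝕜 E' F'] (absConvexHull 𝕜 C)))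
    (hA : Continuous[wStar 𝕜 E F, wStar 𝕜 E' F'] A) :
    Set.MapsTo A (closure[wStar 𝕜 E F] (absConvexHull 𝕜 s))
      (closure[wStar 𝕜 E' F'] (absConvexHull 𝕜 C)) :=
  Set.MapsTo.closure_wStar (absConvexHull_min h
    (absConvex_absConvexHull.closure_wStar.linear_preimage A.toLinearMap)) hA

end ClosedHulls

/-! ### The intertwining operators and their place in L_𝒯(X, X^⊙⊙). -/

namespace C0Semigroup

variable {𝕜 X : Type*} [RCLike 𝕜] [NormedAddCommGroup X] [NormedSpace 𝕜 X]
  (T : C0Semigroup 𝕜 X)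

/-- The operators `V : X → X^⊙*` that intertwine `T(t)` and `T^⊙(t)*` for all `t`. -/
noncomputable def commutant : Submodule 𝕜 (X →L[𝕜] StrongDual 𝕜 T.sun) where
  carrier := {V | ∀ t x φ, V x (T.sunOp t φ) = V (T.toFun t x) φ}
  zero_mem' := fun _ _ _ => rfl
  add_mem' := fun hV hW t x φ => congrArg₂ (· + ·) (hV t x φ) (hW t x φ)
  smul_mem' := fun c _ hV t x φ => congrArg (c • ·) (hV t x φ)

theorem isClosed_commutant : IsClosed[wStar 𝕜 X T.sun] (T.commutant : Set _) := by
  let := wStar 𝕜 X T.sun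
  have h : (T.commutant : Set (X →L[𝕜] StrongDual 𝕜 T.sun)) =
      ⋂ (t) (x) (φ), {V | V x (T.sunOp t φ) = V (T.toFun t x) φ} := by
    ext V
    simp [commutant]
  rw [h]
  exact isClosed_iInter fun t => isClosed_iInter fun x => isClosed_iInter fun φ =>
    isClosed_eq (continuous_wStar_apply _ _) (continuous_wStar_apply _ _)

theorem orbit_subset_commutant : T.orbit ⊆ T.commutant := by
  rintro _ ⟨s, rfl⟩ t x φ
  have h : T.toFun t (T.toFun s x) = T.toFun s (T.toFun t x) := by
    rw [← ContinuousLinearMap.comp_apply, ← T.map_add, add_comm, T.map_add,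
      ContinuousLinearMap.comp_apply]
  exact congrArg (φ : StrongDual 𝕜 X) h

theorem closure_absConvexHull_orbit_subset_commutant :
    closure[wStar 𝕜 X T.sun] (absConvexHull 𝕜 T.orbit) ⊆ T.commutant :=
  @closure_minimal _ (wStar 𝕜 X T.sun) _ _
    (absConvexHull_min T.orbit_subset_commutant T.commutant.absConvex) T.isClosed_commutant

variable {T}

theorem apply_mem_sunSun_of_mem_commutant {V : X →L[𝕜] StrongDual 𝕜 T.sun} (hV : V ∈ T.commutant)
    (x : X) : V x ∈ T.sunSun := by
  rw [mem_sun]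
  have h : ∀ t, (V x).comp (T.sunDual.toFun t) = V (T.toFun t x) := fun t =>
    ContinuousLinearMap.ext fun φ => hV t x φ
  simp only [h]
  exact (V.continuous.tendsto x).comp (T.tendsto_zero x)

theorem flipDual_apply_mem_sun_of_mem_commutant {V : X →L[𝕜] StrongDual 𝕜 T.sun}
    (hV : V ∈ T.commutant) (φ : T.sun) : flipDual 𝕜 X T.sun V φ ∈ T.sun := by
  rw [mem_sun]
  have h : ∀ t, (flipDual 𝕜 X T.sun V φ).comp (T.toFun t) = flipDual 𝕜 X T.sun V (T.sunOp t φ) :=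
    fun t => ContinuousLinearMap.ext fun x => (hV t x φ).symm
  simp only [h]
  exact ((flipDual 𝕜 X T.sun V).continuous.tendsto φ).comp (T.sunDual.tendsto_zero φ)

/-- The restricted adjoint R commutes with T^⊙(t), so composition with R preserves norm convergence
of ψ ∘ T^⊙(t) to ψ. -/
theorem exists_LSunSun_of_mem_commutant {V : X →L[𝕜] StrongDual 𝕜 T.sun} (hV : V ∈ T.commutant) :
    ∃ U : T.LSunSun, T.inclSunSun U.1 = V := by
  let U : X →L[𝕜] T.sunSun := V.codRestrict T.sunSun (apply_mem_sunSun_of_mem_commutant hV)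
  have hU : ∀ φ, T.adjSun U φ ∈ T.sun := flipDual_apply_mem_sun_of_mem_commutant hV
  refine ⟨⟨U, hU, fun ψ hψ => ?_⟩, rfl⟩
  rw [mem_sun] at hψ ⊢
  let R : T.sun →L[𝕜] T.sun := (T.adjSun U).codRestrict T.sun hU
  have h : ∀ t, (ψ.comp R).comp (T.sunDual.toFun t) = (ψ.comp (T.sunDual.toFun t)).comp R := by
    intro t
    rw [ContinuousLinearMap.comp_assoc, ContinuousLinearMap.comp_assoc]
    congr 1
    ext φ x
    exact hV t x φ
  have hc : Continuous fun χ : StrongDual 𝕜 T.sun => χ.comp R :=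
    ((ContinuousLinearMap.compL 𝕜 T.sun T.sun 𝕜).flip R).continuous
  exact ((hc.tendsto ψ).comp hψ).congr fun t => (h t).symm

/-! ### Exchange of 𝒯 and 𝒯^⊙ by the flip; compactness. -/

variable (T)

theorem mapsTo_flipDual_orbit : Set.MapsTo (flipDual 𝕜 X T.sun) T.orbit T.sunOrbit := by
  rintro _ ⟨t, rfl⟩
  exact ⟨t, rfl⟩

theorem mapsTo_flipDual_sunOrbit : Set.MapsTo (flipDual 𝕜 T.sun X) T.sunOrbit T.orbit := by
  rintro _ ⟨t, rfl⟩
  exact ⟨t, rfl⟩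

/-- For U in L_𝒯(X, X^⊙⊙) the flip of U is U^⊙ by definition, and the two flips are mutually
inverse. -/
theorem eq_etaPreimage {C : Set (X →L[𝕜] StrongDual 𝕜 T.sun)}
    {D : Set (T.sun →L[𝕜] StrongDual 𝕜 X)} (hC : C ⊆ T.commutant)
    (hCD : Set.MapsTo (flipDual 𝕜 X T.sun) C D)
    (hDC : Set.MapsTo (flipDual 𝕜 T.sun X) D C) : C = T.etaPreimage D := by
  ext V
  constructor
  · intro hV
    obtain ⟨U, rfl⟩ := exists_LSunSun_of_mem_commutant (hC hV)
    exact ⟨U, hCD hV, rfl⟩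
  · rintro ⟨U, hU, rfl⟩
    exact hDC hU

theorem closure_sunOrbit_subset :
    closure[wStar 𝕜 T.sun X] T.sunOrbit ⊆ Set.range T.inclSun := by
  intro S hS
  have h : flipDual 𝕜 T.sun X S ∈ T.commutant :=
    @closure_minimal _ (wStar 𝕜 X T.sun) _ _ T.orbit_subset_commutant T.isClosed_commutant _
      (Set.MapsTo.closure_wStar (T.mapsTo_flipDual_sunOrbit.mono_right
        (@subset_closure _ (wStar 𝕜 X T.sun) _)) continuous_wStar_flipDual hS)
  have hS' : ∀ φ, S φ ∈ T.sun := fun φ => by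
    rw [← flipDual_flipDual S]
    exact flipDual_apply_mem_sun_of_mem_commutant h φ
  exact ⟨S.codRestrict T.sun hS', rfl⟩

theorem norm_le_of_mem_orbit {M : ℝ} (hT : ∀ t, ‖T.toFun t‖ ≤ M)
    {V : X →L[𝕜] StrongDual 𝕜 T.sun} (hV : V ∈ T.orbit) : ‖V‖ ≤ M := by
  obtain ⟨t, rfl⟩ := hV
  have hM0 : 0 ≤ M := (norm_nonneg _).trans (hT 0)
  refine ContinuousLinearMap.opNorm_le_bound₂ _ hM0 fun x φ => ?_
  change ‖(φ : StrongDual 𝕜 X) (T.toFun t x)‖ ≤ _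
  rw [mul_comm]
  refine ((φ : StrongDual 𝕜 X).le_opNorm _).trans ?_
  refine mul_le_mul_of_nonneg_left ?_ (norm_nonneg _)
  exact ((T.toFun t).le_opNorm x).trans (by gcongr; exact hT t)

theorem isCompact_closure_of_subset_absConvexHull (hT : ∃ M : ℝ, ∀ t, ‖T.toFun t‖ ≤ M)
    {s : Set (X →L[𝕜] StrongDual 𝕜 T.sun)} (hs : s ⊆ absConvexHull 𝕜 T.orbit) :
    @IsCompact _ (wStar 𝕜 X T.sun) (closure[wStar 𝕜 X T.sun] s) := by
  obtain ⟨M, hM⟩ := hT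
  refine isCompact_wStar_of_isClosed (M := M) (fun V hV => ?_)
    (@isClosed_closure _ (wStar 𝕜 X T.sun) _)
  exact norm_le_of_mem_closure_wStar ((norm_nonneg _).trans (hM 0))
    (fun W hW => norm_le_of_mem_absConvexHull (fun _ => T.norm_le_of_mem_orbit hM) (hs hW)) hV

/-! ### The product ∘ on the closed hulls. -/

/-- Composition with `R` from `X^⊙`: the map `V ↦ (x ↦ (φ ↦ ⟨V x, R φ⟩))` on `L(X, X^⊙*)`. -/
noncomputable def precompSun (R : T.sun →L[𝕜] T.sun) :
    (X →L[𝕜] StrongDual 𝕜 T.sun) →L[𝕜] (X →L[𝕜] StrongDual 𝕜 T.sun) :=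
  ContinuousLinearMap.compL 𝕜 X (StrongDual 𝕜 T.sun) (StrongDual 𝕜 T.sun)
    ((ContinuousLinearMap.compL 𝕜 T.sun T.sun 𝕜).flip R)

theorem continuous_wStar_precompSun (R : T.sun →L[𝕜] T.sun) :
    Continuous[wStar 𝕜 X T.sun, wStar 𝕜 X T.sun] (T.precompSun R) :=
  continuous_wStar_of_elemTensor_comp_mem _ fun x φ => elemTensor_mem_projPredual x (R φ)

/-- Composition with `T(t)` from the right on `L(X, X^⊙*)`. -/
noncomputable def compToFun (t : ℝ≥0) :
    (X →L[𝕜] StrongDual 𝕜 T.sun) →L[𝕜] (X →L[𝕜] StrongDual 𝕜 T.sun) :=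
  (ContinuousLinearMap.compL 𝕜 X X (StrongDual 𝕜 T.sun)).flip (T.toFun t)

theorem continuous_wStar_compToFun (t : ℝ≥0) :
    Continuous[wStar 𝕜 X T.sun, wStar 𝕜 X T.sun] (T.compToFun t) :=
  continuous_wStar_of_elemTensor_comp_mem _ fun x φ =>
    elemTensor_mem_projPredual (T.toFun t x) φ

theorem inclSunSun_opMul (U V : T.LSunSun) :
    T.inclSunSun (T.opMul U V).1 = T.precompSun (T.sunAdjoint U) (T.inclSunSun V.1) := rfl

theorem inclSunSun_injective : Function.Injective fun U : T.LSunSun => T.inclSunSun U.1 := by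
  intro U V h
  refine Subtype.ext (ContinuousLinearMap.ext fun x => Subtype.ext ?_)
  exact congrArg (fun W : X →L[𝕜] StrongDual 𝕜 T.sun => W x) h

/-- Both sides pair W x with V^⊙ U^⊙ φ. -/
theorem opMul_assoc (U V W : T.LSunSun) :
    T.opMul (T.opMul U V) W = T.opMul U (T.opMul V W) := by
  apply T.inclSunSun_injective
  ext x φ
  rfl

/-- A set of intertwining operators that contains the orbit and is preserved by every weak-star
continuous linear map sending the orbit into it is a right semitopological semigroup. -/
theorem isRightSemitopological_of_mapsTo {C : Set (X →L[𝕜] StrongDual 𝕜 T.sun)}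
    (horb : T.orbit ⊆ C) (hC : C ⊆ T.commutant)
    (hmaps : ∀ A : (X →L[𝕜] StrongDual 𝕜 T.sun) →L[𝕜] (X →L[𝕜] StrongDual 𝕜 T.sun),
      Continuous[wStar 𝕜 X T.sun, wStar 𝕜 X T.sun] A → Set.MapsTo A T.orbit C →
        Set.MapsTo A C C) :
    T.IsRightSemitopological C := by
  have hcomp : ∀ t, Set.MapsTo (T.compToFun t) C C := by
    intro t
    refine hmaps _ (T.continuous_wStar_compToFun t) ?_
    rintro _ ⟨s, rfl⟩
    refine horb ⟨s + t, ?_⟩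
    ext x φ
    change (φ : StrongDual 𝕜 X) (T.toFun (s + t) x) = (φ : StrongDual 𝕜 X) (T.toFun s (T.toFun t x))
    rw [T.map_add]
    rfl
  have hmul : ∀ U ∈ T.partLSunSun C, ∀ V ∈ T.partLSunSun C, T.opMul U V ∈ T.partLSunSun C := by
    intro U hU V hV
    change T.inclSunSun (T.opMul U V).1 ∈ C
    rw [inclSunSun_opMul]
    refine hmaps _ (T.continuous_wStar_precompSun _) ?_ hV
    rintro _ ⟨t, rfl⟩
    -- On the orbit, U ∘ T(t) is U T(t), because ⟨T(t)x, U^⊙φ⟩ = ⟨U T(t)x, φ⟩.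
    exact hcomp t hU
  refine ⟨fun V hV => exists_LSunSun_of_mem_commutant (hC hV), hmul, ?_⟩
  let := wStar 𝕜 X T.sun
  let : TopologicalSpace (T.partLSunSun C) :=
    TopologicalSpace.induced (fun U => T.inclSunSun U.1.1) (wStar 𝕜 X T.sun)
  have hind : Continuous fun U : T.partLSunSun C => T.inclSunSun U.1.1 := continuous_induced_dom
  refine ⟨?_, ?_, fun U V W => Subtype.ext (T.opMul_assoc _ _ _), fun U => ?_⟩
  · obtain ⟨U, hU⟩ := exists_LSunSun_of_mem_commutant (T.orbit_subset_commutant ⟨0, rfl⟩)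
    refine ⟨⟨U, ?_⟩⟩
    change T.inclSunSun U.1 ∈ C
    rw [hU]
    exact horb ⟨0, rfl⟩
  · have := t2Space_wStar (𝕜 := 𝕜) (E := X) (F := T.sun)
    exact T2Space.of_injective_continuous
      (T.inclSunSun_injective.comp Subtype.val_injective) hind
  · exact continuous_induced_rng.2 ((T.continuous_wStar_precompSun (T.sunAdjoint U.1)).comp hind)

end C0Semigroup

theorem theorem7p3 {𝕜 X : Type*} [RCLike 𝕜] [NormedAddCommGroup X] [NormedSpace 𝕜 X]
    [CompleteSpace X] (T : C0Semigroup 𝕜 X) (hT : ∃ M : ℝ, ∀ t, ‖T.toFun t‖ ≤ M) :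
    -- the closure of the sun-dual semigroup lies in `L(X^⊙)`
    closure[wStar 𝕜 T.sun X] T.sunOrbit ⊆ Set.range T.inclSun ∧
    -- the closure and the two closed hulls of `𝒯` are preimages under `η^⊙`
    closure[wStar 𝕜 X T.sun] T.orbit = T.etaPreimage (closure[wStar 𝕜 T.sun X] T.sunOrbit) ∧
    closure[wStar 𝕜 X T.sun] (convexHull ℝ T.orbit) =
      T.etaPreimage (closure[wStar 𝕜 T.sun X] (convexHull ℝ T.sunOrbit)) ∧
    closure[wStar 𝕜 X T.sun] (absConvexHull 𝕜 T.orbit) =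
      T.etaPreimage (closure[wStar 𝕜 T.sun X] (absConvexHull 𝕜 T.sunOrbit)) ∧
    -- the chain of inclusions
    (T.orbit ⊆ closure[wStar 𝕜 X T.sun] T.orbit ∧
      closure[wStar 𝕜 X T.sun] T.orbit ⊆ closure[wStar 𝕜 X T.sun] (convexHull ℝ T.orbit) ∧
      closure[wStar 𝕜 X T.sun] (convexHull ℝ T.orbit) ⊆
        closure[wStar 𝕜 X T.sun] (absConvexHull 𝕜 T.orbit) ∧
      closure[wStar 𝕜 X T.sun] (absConvexHull 𝕜 T.orbit) ⊆ Set.range T.inclSunSun) ∧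
    -- the closure
    (@IsCompact _ (wStar 𝕜 X T.sun) (closure[wStar 𝕜 X T.sun] T.orbit) ∧
      T.IsRightSemitopological (closure[wStar 𝕜 X T.sun] T.orbit)) ∧
    -- the closed convex hull
    (Convex ℝ (closure[wStar 𝕜 X T.sun] (convexHull ℝ T.orbit)) ∧
      @IsCompact _ (wStar 𝕜 X T.sun) (closure[wStar 𝕜 X T.sun] (convexHull ℝ T.orbit)) ∧
      T.IsRightSemitopological (closure[wStar 𝕜 X T.sun] (convexHull ℝ T.orbit))) ∧
    -- the closed absolutely convex hull
    (AbsConvex 𝕜 (closure[wStar 𝕜 X T.sun] (absConvexHull 𝕜 T.orbit)) ∧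
      @IsCompact _ (wStar 𝕜 X T.sun) (closure[wStar 𝕜 X T.sun] (absConvexHull 𝕜 T.orbit)) ∧
      T.IsRightSemitopological (closure[wStar 𝕜 X T.sun] (absConvexHull 𝕜 T.orbit))) := by
  let τ : TopologicalSpace (X →L[𝕜] StrongDual 𝕜 T.sun) := wStar 𝕜 X T.sun
  let τ' : TopologicalSpace (T.sun →L[𝕜] StrongDual 𝕜 X) := wStar 𝕜 T.sun X
  have hco : convexHull ℝ T.orbit ⊆ absConvexHull 𝕜 T.orbit :=
    convexHull_real_subset_absConvexHull T.orbit
  have hac : T.orbit ⊆ absConvexHull 𝕜 T.orbit := subset_absConvexHull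
  have h₁ : @closure _ τ T.orbit ⊆ @closure _ τ (convexHull ℝ T.orbit) :=
    @closure_mono _ τ _ _ (subset_convexHull ℝ T.orbit)
  have h₂ : @closure _ τ (convexHull ℝ T.orbit) ⊆ @closure _ τ (absConvexHull 𝕜 T.orbit) :=
    @closure_mono _ τ _ _ hco
  have h₃ := T.closure_absConvexHull_orbit_subset_commutant
  have h₀ : T.orbit ⊆ @closure _ τ T.orbit := @subset_closure _ τ _
  have h₀' : T.sunOrbit ⊆ @closure _ τ' T.sunOrbit := @subset_closure _ τ' _
  have h₁' : @closure _ τ' T.sunOrbit ⊆ @closure _ τ' (convexHull ℝ T.sunOrbit) :=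
    @closure_mono _ τ' _ _ (subset_convexHull ℝ T.sunOrbit)
  have h₂' : @closure _ τ' T.sunOrbit ⊆ @closure _ τ' (absConvexHull 𝕜 T.sunOrbit) :=
    @closure_mono _ τ' _ _ subset_absConvexHull
  have hf₀ : Set.MapsTo (flipDual 𝕜 X T.sun) T.orbit (@closure _ τ' T.sunOrbit) :=
    T.mapsTo_flipDual_orbit.mono_right h₀'
  have hg₀ : Set.MapsTo (flipDual 𝕜 T.sun X) T.sunOrbit (@closure _ τ T.orbit) :=
    T.mapsTo_flipDual_sunOrbit.mono_right h₀
  refine ⟨T.closure_sunOrbit_subset, ?_, ?_, ?_, ⟨h₀, h₁, h₂, ?_⟩, ⟨?_, ?_⟩, ⟨?_, ?_, ?_⟩,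
    ?_, ?_, ?_⟩
  · exact T.eq_etaPreimage ((h₁.trans h₂).trans h₃)
      (hf₀.closure_wStar continuous_wStar_flipDual) (hg₀.closure_wStar continuous_wStar_flipDual)
  · exact T.eq_etaPreimage (h₂.trans h₃)
      ((hf₀.mono_right h₁').closure_convexHull_wStar continuous_wStar_flipDual)
      ((hg₀.mono_right h₁).closure_convexHull_wStar continuous_wStar_flipDual)
  · exact T.eq_etaPreimage h₃
      ((hf₀.mono_right h₂').closure_absConvexHull_wStar continuous_wStar_flipDual)
      ((hg₀.mono_right (h₁.trans h₂)).closure_absConvexHull_wStar continuous_wStar_flipDual)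
  · intro V hV
    obtain ⟨U, rfl⟩ := C0Semigroup.exists_LSunSun_of_mem_commutant (h₃ hV)
    exact ⟨U.1, rfl⟩
  · exact T.isCompact_closure_of_subset_absConvexHull hT hac
  · exact T.isRightSemitopological_of_mapsTo h₀ ((h₁.trans h₂).trans h₃)
      fun A hA h => Set.MapsTo.closure_wStar h hA
  · exact (convex_convexHull ℝ T.orbit).closure_wStar
  · exact T.isCompact_closure_of_subset_absConvexHull hT hco
  · exact T.isRightSemitopological_of_mapsTo (h₀.trans h₁) (h₂.trans h₃)
      fun A hA h => Set.MapsTo.closure_convexHull_wStar h hA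
  · exact absConvex_absConvexHull.closure_wStar
  · exact T.isCompact_closure_of_subset_absConvexHull hT subset_rfl
  · exact T.isRightSemitopological_of_mapsTo ((h₀.trans h₁).trans h₂) h₃
      fun A hA h => Set.MapsTo.closure_absConvexHull_wStar h hA
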